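/- Let $X$ be a real Banach space with closed unit ball $B_X$, and let $\mathscr B(X)$ be the family of all nonempty bounded subsets of $X$, with Minkowski sum and scalar multiplication of sets, ordered by inclusion. A function $\mu:\mathscr B(X)\to[0,\infty)$ is a *convex measure of noncompactness* (convex MNC) if for all $A,B\in\mathscr B(X)$: $\mu(B)=0$ if and only if $B$ is relatively compact; $A\subset B$ implies $\mu(A)\le\mu(B)$; $\mu(\mathrm{co}\,B)=\mu(B)$; and $\mu(\lambda A+(1-\lambda)B)\le\lambda\mu(A)+(1-\lambda)\mu(B)$ for $0\le\lambda\le1$. It is a *sublinear MNC* if it satisfies the first three of these conditions, $\mu(A+B)\le\mu(A)+\mu(B)$, and $\mu(kB)=k\mu(B)$ for $k\ge0$. Let $\Omega$ be the closed unit ball of $X^*$ with the norm topology and $C_b(\Omega)$ the space of bounded continuous real functions on $\Omega$ with the sup norm and the pointwise order. For $A\in\mathscr B(X)$ let $J(A)\in C_b(\Omega)$ be the support function $J(A)(x^*)=\sup_{a\in A}\langle x^*,a\rangle$. Let $\mathscr C$ (resp. $\mathscr K$) be the family of nonempty bounded closed convex (resp. nonempty compact convex) subsets of $X$, let $E_{\mathscr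 C}=\overline{J\mathscr C-J\mathscr C}$ and $E_{\mathscr K}=\overline{J\mathscr K-J\mathscr K}$ in $C_b(\Omega)$, let $I_{\mathscr K}$ be the closed lattice ideal of the Banach lattice $E_{\mathscr C}$ generated by $E_{\mathscr K}$, and let $Q:E_{\mathscr C}\to E_{\mathscr C}/I_{\mathscr K}$ be the quotient map onto the quotient Banach lattice. **Theorem.** For every real Banach space $X$ there are a compact Hausdorff space $K$ and a linear order isometry $T$ of $E_{\mathscr C}/I_{\mathscr K}$ onto a sublattice of $C(K)$ such that the map $\mathbb T:\mathscr B(X)\to C(K)$, $\mathbb T(B)=TQJ(\overline{\mathrm{co}}\,B)$, is order preserving, affine (i.e. $\mathbb T(aA+bB)=a\mathbb T(A)+b\mathbb T(B)$ for $a,b\ge0$) and takes values in $C(K)^+$, its image $V=\mathbb T(\mathscr B(X))\subset C(K)^+$ is a convex cone, and the following holds. For every convex MNC $\mu$ on $X$ there is a function $\digamma$ on $V$ such that 1. $\mu(B)=\digamma(\mathbb T B)$ for all $B\in\mathscr B(X)$; 2. $\digamma$ is nonnegative, convex and monotone (for the order of $C(K)$) on $V$; 3. for every $r\ge0$, $\digamma\le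 b_r$ on $V\cap rB_{C(K)}$, where $b_r=\digamma(r\,\mathbb T B_X)=\mu(rB_X)$; 4. for every $r\ge0$, $\digamma$ is $c_r$-Lipschitz on $V\cap rB_{C(K)}$, where $c_r=\digamma((1+r)\mathbb T B_X)=\mu((1+r)B_X)$; 5. if $\mu$ is a sublinear MNC, then one can take $c_r=\mu(B_X)$ in 4. -/

import Mathlib

open scoped Pointwise BoundedContinuousFunction

universe u

namespace MNC

section Sets

variable (X : Type u) [NormedAddCommGroup X] [NormedSpace ℝ X]

/-- The family of all nonempty bounded subsets of `X`. -/
structure BddSet where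
  carrier : Set X
  nonempty : carrier.Nonempty
  bounded : Bornology.IsBounded carrier

variable {X}

namespace BddSet

/-- Ordered by inclusion. -/
instance : LE (BddSet X) := ⟨fun A B => A.carrier ⊆ B.carrier⟩

/-- Minkowski sum. -/
instance : Add (BddSet X) :=
  ⟨fun A B => ⟨A.carrier + B.carrier, A.nonempty.add B.nonempty, A.bounded.add B.bounded⟩⟩

/-- `k • B = {k b : b ∈ B}`. -/
instance : SMul ℝ (BddSet X) :=
  ⟨fun k B => ⟨k • B.carrier, B.nonempty.smul_set, B.bounded.smul₀ k⟩⟩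

/-- The convex hull. -/
def co (B : BddSet X) : BddSet X :=
  ⟨convexHull ℝ B.carrier, B.nonempty.convexHull, isBounded_convexHull.2 B.bounded⟩

/-- The closed convex hull. -/
def closedCo (B : BddSet X) : BddSet X :=
  ⟨closure (convexHull ℝ B.carrier), B.nonempty.convexHull.closure,
    (isBounded_convexHull.2 B.bounded).closure⟩

variable (X) in
/-- The closed unit ball of `X`. -/
def unitBall : BddSet X :=
  ⟨Metric.closedBall 0 1, ⟨0, by simp⟩, Metric.isBounded_closedBall⟩

end BddSet

/-- Convex measures of noncompactness. -/
structure IsConvexMNC (μ : BddSet X → ℝ) : Prop where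
  nonneg : ∀ B, 0 ≤ μ B
  noncompactness : ∀ B, μ B = 0 ↔ IsCompact (closure B.carrier)
  monotone : ∀ A B, A ≤ B → μ A ≤ μ B
  convexification : ∀ B : BddSet X, μ B.co = μ B
  convexity : ∀ (A B : BddSet X) (t : ℝ), 0 ≤ t → t ≤ 1 →
    μ (t • A + (1 - t) • B) ≤ t * μ A + (1 - t) * μ B

/-- Sublinear measures of noncompactness. -/
structure IsSublinearMNC (μ : BddSet X → ℝ) : Prop where
  nonneg : ∀ B, 0 ≤ μ B
  noncompactness : ∀ B, μ B = 0 ↔ IsCompact (closure B.carrier)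
  monotone : ∀ A B, A ≤ B → μ A ≤ μ B
  convexification : ∀ B : BddSet X, μ B.co = μ B
  subadditivity : ∀ A B : BddSet X, μ (A + B) ≤ μ A + μ B
  homogeneity : ∀ (B : BddSet X) (k : ℝ), 0 ≤ k → μ (k • B) = k * μ B

variable (X) in
/-- The closed unit ball of the dual space, with the norm topology. -/
abbrev Omega : Type u := Metric.closedBall (0 : StrongDual ℝ X) 1

/-- The support function of `A`, on the dual unit ball. -/
noncomputable def supp (A : BddSet X) (x : Omega X) : ℝ :=
  sSup ((fun a => x.1 a) '' A.carrier)

theorem supp_bdd (A : BddSet X) :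
    ∃ M : ℝ, ∀ a ∈ A.carrier, ∀ y : StrongDual ℝ X, y a ≤ M * ‖y‖ := by
  obtain ⟨M, hM⟩ := A.bounded.exists_norm_le
  refine ⟨M, fun a ha y => ?_⟩
  calc y a ≤ ‖y a‖ := Real.le_norm_self _
    _ ≤ ‖y‖ * ‖a‖ := y.le_opNorm a
    _ ≤ ‖y‖ * M := by gcongr; exact hM a ha
    _ = M * ‖y‖ := mul_comm _ _

theorem supp_sub_le (A : BddSet X) {M : ℝ}
    (hM : ∀ a ∈ A.carrier, ∀ y : StrongDual ℝ X, y a ≤ M * ‖y‖) (x y : Omega X) :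
    supp A x ≤ supp A y + M * ‖x.1 - y.1‖ := by
  refine csSup_le (A.nonempty.image _) ?_
  rintro _ ⟨a, ha, rfl⟩
  have h1 : y.1 a ≤ supp A y :=
    le_csSup ⟨M * ‖y.1‖, by rintro _ ⟨b, hb, rfl⟩; exact hM b hb y.1⟩ ⟨a, ha, rfl⟩
  have h2 := hM a ha (x.1 - y.1)
  simp only [sub_apply] at h2
  show x.1 a ≤ _
  linarith

theorem supp_continuous (A : BddSet X) : Continuous (supp A) := by
  obtain ⟨M, hM⟩ := supp_bdd A
  refine (LipschitzWith.of_le_add_mul (Real.toNNReal M) fun x y => ?_).continuous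
  refine (supp_sub_le A hM x y).trans ?_
  rw [Subtype.dist_eq, dist_eq_norm]
  gcongr
  exact Real.le_coe_toNNReal M

theorem supp_zero (A : BddSet X) (z : Omega X) (hz : z.1 = 0) : supp A z = 0 := by
  have : (fun a => z.1 a) '' A.carrier = {0} := by
    simp [hz, A.nonempty]
  simp [supp, this]

theorem supp_bound (A : BddSet X) : ∃ C : ℝ, ∀ x, ‖supp A x‖ ≤ C := by
  obtain ⟨M, hM⟩ := supp_bdd A
  refine ⟨|M|, fun x => ?_⟩
  let z : Omega X := ⟨0, by simp⟩
  have hx : ‖x.1‖ ≤ 1 := mem_closedBall_zero_iff.1 x.2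
  have h1 := supp_sub_le A hM x z
  have h2 := supp_sub_le A hM z x
  rw [supp_zero A z rfl] at h1 h2
  have e1 : ‖x.1 - z.1‖ = ‖x.1‖ := by simp [z]
  have e2 : ‖z.1 - x.1‖ = ‖x.1‖ := by simp [z]
  rw [e1] at h1
  rw [e2] at h2
  have h3 : M * ‖x.1‖ ≤ |M| := by
    calc M * ‖x.1‖ ≤ |M| * ‖x.1‖ := by gcongr; exact le_abs_self M
      _ ≤ |M| * 1 := by gcongr
      _ = |M| := mul_one _
  rw [Real.norm_eq_abs, abs_le]
  constructor <;> linarith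

/-- The embedding `J`, sending `A` to its support function in `C_b(Ω)`. -/
noncomputable def J (A : BddSet X) : Omega X →ᵇ ℝ :=
  BoundedContinuousFunction.ofNormedAddCommGroup (supp A) (supp_continuous A)
    (supp_bound A).choose (supp_bound A).choose_spec

variable (X) in
/-- The nonempty bounded closed convex sets. -/
def ClosedConvex : Set (BddSet X) := {C | IsClosed C.carrier ∧ Convex ℝ C.carrier}

variable (X) in
/-- The nonempty compact convex sets. -/
def CompactConvex : Set (BddSet X) := {C | IsCompact C.carrier ∧ Convex ℝ C.carrier}

variable (X) in
/-- `E_𝒞`, the closure of `J 𝒞 - J 𝒞`; as `J 𝒞` is a convex cone, `J 𝒞 - J 𝒞` is its span. -/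
noncomputable def EC : Submodule ℝ (Omega X →ᵇ ℝ) :=
  (Submodule.span ℝ (J '' ClosedConvex X)).topologicalClosure

variable (X) in
/-- `E_𝒦`, the closure of `J 𝒦 - J 𝒦`; as `J 𝒦` is a convex cone, `J 𝒦 - J 𝒦` is its span. -/
noncomputable def EK : Submodule ℝ (Omega X →ᵇ ℝ) :=
  (Submodule.span ℝ (J '' CompactConvex X)).topologicalClosure

variable (X) in
/-- `E_𝒞` as a normed space (with the sup norm); `f.1` is the underlying function on `Ω`. -/
def E : Type u := EC X

noncomputable instance : NormedAddCommGroup (E X) := inferInstanceAs (NormedAddCommGroup (EC X))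

noncomputable instance : NormedSpace ℝ (E X) := inferInstanceAs (NormedSpace ℝ (EC X))

/-- Lattice ideals of the Banach lattice `E_𝒞` (order and modulus are pointwise): the solid linear
subspaces. Such a subspace is automatically a sublattice, since it contains `|y|` with `y`. -/
def IsLatticeIdeal (Y : Submodule ℝ (E X)) : Prop :=
  ∀ y ∈ Y, ∀ z : E X, |z.1| ≤ |y.1| → z ∈ Y

variable (X) in
/-- The closed lattice ideal of `E_𝒞` generated by `E_𝒦`. -/
noncomputable def IK : Submodule ℝ (E X) :=
  sInf {Y | IsClosed (Y : Set (E X)) ∧ IsLatticeIdeal Y ∧ ∀ h : E X, h.1 ∈ EK X → h ∈ Y}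

variable (X) in
/-- The quotient Banach lattice of `E_𝒞` by the closed lattice ideal generated by `E_𝒦`,
with the quotient norm. -/
abbrev EQ : Type u := E X ⧸ IK X

/-- The quotient map. -/
noncomputable def Q (h : E X) : EQ X := (IK X).mkQ h

/-- `T` is an order isometry of the quotient lattice onto a sublattice of `C(K)`. The order of the
quotient is the usual one: `Q f ≤ Q g` iff `f ≤ g + h` for some `h` in the ideal. -/
structure IsOrderIsometry {K : Type u} [TopologicalSpace K] [CompactSpace K]
    (T : EQ X →ₗᵢ[ℝ] C(K, ℝ)) : Prop where
  le_iff : ∀ f g : E X, T (Q f) ≤ T (Q g) ↔ ∃ h ∈ IK X, f.1 ≤ g.1 + h.1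
  sup_mem : ∀ p q : EQ X, T p ⊔ T q ∈ Set.range T
  inf_mem : ∀ p q : EQ X, T p ⊓ T q ∈ Set.range T

theorem J_closedCo_mem (B : BddSet X) : J B.closedCo ∈ EC X :=
  Submodule.le_topologicalClosure _ (Submodule.subset_span
    ⟨B.closedCo, ⟨isClosed_closure, (convex_convexHull ℝ B.carrier).closure⟩, rfl⟩)

/-- The map `𝕋 = T Q J` on bounded sets, `𝕋 B = T Q J (closed convex hull of B)`. -/
noncomputable def TQJ {K : Type u} [TopologicalSpace K] [CompactSpace K]
    (T : EQ X →ₗᵢ[ℝ] C(K, ℝ)) (B : BddSet X) : C(K, ℝ) :=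
  T (Q ⟨J B.closedCo, J_closedCo_mem B⟩)

end Sets

end MNC

/-! Elements of `E_𝒞` are positively homogeneous, so they are determined by their values on the dual
unit sphere, where `J B_X` equals 1. Thus `J B_X` acts as an order unit. The quotient is represented
concretely: extend to the Stone–Čech compactification of the sphere and restrict to the closed set
`hull X` where the ideal vanishes. Compactness and truncation by multiples of `J B_X` show that this
is isometric on the quotient.

The heart is `IsConvexMNC.le_of_TQJ_le`: `𝕋 A ≤ 𝕋 B` implies `μ A ≤ μ B`. Members of the ideal are
dominated on the sphere by `ε + J C` with `C` compact, so Hahn–Banach puts `A` inside the convex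
hull of `B + C` plus a small ball. In a convex combination the compact part may be scaled up at
will, since `μ` vanishes on compact sets; letting the ball shrink gives the claim. Hence `μ` factors
through `𝕋`, and the factor inherits monotonicity and convexity. The bounds follow from `𝕋 B_X = 1`:
a norm estimate in `C(K)` is an order estimate by a multiple of `𝕋 B_X`. -/

namespace MNC

/-! ### Support functions and Minkowski operations -/

section SupportFunctions

variable {X : Type u} [NormedAddCommGroup X] [NormedSpace ℝ X]

theorem supp_bddAbove (A : BddSet X) (x : Omega X) :
    BddAbove ((fun a => x.1 a) '' A.carrier) := by
  obtain ⟨M, hM⟩ := supp_bdd A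
  exact ⟨M * ‖x.1‖, by rintro _ ⟨a, ha, rfl⟩; exact hM a ha x.1⟩

theorem le_J {A : BddSet X} {a : X} (ha : a ∈ A.carrier) (x : Omega X) : x.1 a ≤ J A x :=
  le_csSup (supp_bddAbove A x) ⟨a, ha, rfl⟩

theorem J_le {A : BddSet X} {x : Omega X} {c : ℝ} (h : ∀ a ∈ A.carrier, x.1 a ≤ c) :
    J A x ≤ c := by
  refine csSup_le (A.nonempty.image _) ?_
  rintro _ ⟨a, ha, rfl⟩
  exact h a ha

theorem J_mono {A B : BddSet X} (h : A ≤ B) (x : Omega X) : J A x ≤ J B x :=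
  J_le fun _ ha => le_J (h ha) x

theorem J_closedCo (A : BddSet X) : J A.closedCo = J A := by
  ext x
  refine le_antisymm (J_le fun a ha => ?_)
    (J_mono ((subset_convexHull ℝ _).trans subset_closure) x)
  have hcl : IsClosed {a : X | x.1 a ≤ J A x} := isClosed_le x.1.continuous continuous_const
  have hco : Convex ℝ {a : X | x.1 a ≤ J A x} :=
    convex_halfSpace_le x.1.toLinearMap.isLinear _
  exact closure_minimal (convexHull_min (fun b hb => le_J hb x) hco) hcl ha

theorem J_add (A B : BddSet X) : J (A + B) = J A + J B := by
  ext x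
  apply le_antisymm
  · refine J_le ?_
    rintro _ ⟨a, ha, b, hb, rfl⟩
    have h1 := le_J ha x
    have h2 := le_J hb x
    simp only [map_add, BoundedContinuousFunction.coe_add, Pi.add_apply]
    linarith
  · have h : ∀ b ∈ B.carrier, x.1 b ≤ J (A + B) x - J A x := by
      intro b hb
      have : J A x ≤ J (A + B) x - x.1 b := J_le fun a ha => by
        have := le_J (A := A + B) (Set.add_mem_add ha hb) x
        rw [map_add] at this
        linarith
      linarith
    have := J_le h
    simp only [BoundedContinuousFunction.coe_add, Pi.add_apply]
    linarith

theorem J_smul (A : BddSet X) {k : ℝ} (hk : 0 ≤ k) : J (k • A) = k • J A := by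
  ext x
  simp only [BoundedContinuousFunction.coe_smul, smul_eq_mul]
  apply le_antisymm
  · refine J_le ?_
    rintro _ ⟨a, ha, rfl⟩
    simp only [map_smul, smul_eq_mul]
    exact mul_le_mul_of_nonneg_left (le_J ha x) hk
  · rcases hk.eq_or_lt with rfl | hk
    · obtain ⟨a, ha⟩ := A.nonempty
      have := le_J (A := (0 : ℝ) • A) (Set.smul_mem_smul_set ha) x
      simpa using this
    · rw [← le_div_iff₀' hk]
      refine J_le fun a ha => ?_
      rw [le_div_iff₀' hk]
      have := le_J (A := k • A) (Set.smul_mem_smul_set ha) x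
      simpa using this

/-- The union of two bounded sets. -/
def BddSet.union (A B : BddSet X) : BddSet X :=
  ⟨A.carrier ∪ B.carrier, A.nonempty.inl, A.bounded.union B.bounded⟩

theorem J_union (A B : BddSet X) : J (A.union B) = J A ⊔ J B := by
  ext x
  simp only [BoundedContinuousFunction.coe_sup, Pi.sup_apply]
  apply le_antisymm
  · refine J_le ?_
    rintro a (ha | ha)
    · exact (le_J ha x).trans le_sup_left
    · exact (le_J ha x).trans le_sup_right
  · exact sup_le (J_mono Set.subset_union_left x) (J_mono Set.subset_union_right x)

/-- A one-point set. -/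
def BddSet.point (a : X) : BddSet X := ⟨{a}, Set.singleton_nonempty a, Bornology.isBounded_singleton⟩

theorem J_point_zero : J (BddSet.point (0 : X)) = 0 := by
  ext x
  apply le_antisymm
  · refine J_le ?_
    rintro _ rfl
    simp
  · have := le_J (A := BddSet.point (0 : X)) rfl x
    simpa using this

theorem J_unitBall {x : Omega X} (hx : ‖x.1‖ = 1) : J (BddSet.unitBall X) x = 1 := by
  apply le_antisymm
  · refine J_le fun a ha => ?_
    have ha' : ‖a‖ ≤ 1 := mem_closedBall_zero_iff.1 ha
    calc x.1 a ≤ ‖x.1 a‖ := Real.le_norm_self _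
      _ ≤ ‖x.1‖ * ‖a‖ := x.1.le_opNorm a
      _ ≤ 1 := by rw [hx, one_mul]; exact ha'
  · refine hx.symm.trans_le ?_
    have h0 : 0 ≤ J (BddSet.unitBall X) x := by
      have := le_J (A := BddSet.unitBall X) (a := 0) (by simp [BddSet.unitBall]) x
      simpa using this
    refine ContinuousLinearMap.opNorm_le_of_unit_norm h0 fun a ha => ?_
    rw [Real.norm_eq_abs, abs_le']
    refine ⟨le_J (by simp [BddSet.unitBall, ha]) x, ?_⟩
    rw [← map_neg]
    exact le_J (by simp [BddSet.unitBall, ha]) x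

theorem J_homogeneous (A : BddSet X) {x y : Omega X} {t : ℝ} (ht : 0 ≤ t) (h : y.1 = t • x.1) :
    J A y = t * J A x := by
  have e : (fun a => y.1 a) '' A.carrier = t • ((fun a => x.1 a) '' A.carrier) := by
    rw [h, ← Set.image_smul, Set.image_image]
    rfl
  show sSup _ = t * sSup _
  rw [e, Real.sSup_smul_of_nonneg ht, smul_eq_mul]

/-- Normalisation of a point of the dual ball. -/
theorem exists_unit_smul {x : Omega X} (hx : x.1 ≠ 0) :
    ∃ y : Omega X, ‖y.1‖ = 1 ∧ x.1 = ‖x.1‖ • y.1 := by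
  have h : ‖‖x.1‖⁻¹ • x.1‖ = 1 := norm_smul_inv_norm (𝕜 := ℝ) hx
  exact ⟨⟨‖x.1‖⁻¹ • x.1, by simp [h]⟩, h, by simp [smul_smul, norm_ne_zero_iff.2 hx]⟩

/-- Hahn–Banach: a functional separating a point of `A` from the closed convex hull of `B`,
normalised to the sphere, would violate the inequality. -/
theorem subset_closedCo_of_J_le {A B : BddSet X}
    (h : ∀ x : Omega X, ‖x.1‖ = 1 → J A x ≤ J B x) : A ≤ B.closedCo := by
  intro a ha
  by_contra hab
  obtain ⟨f, c, hfB, hfa⟩ := geometric_hahn_banach_closed_point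
    (convex_convexHull ℝ B.carrier).closure isClosed_closure hab
  have hf : f ≠ 0 := by
    rintro rfl
    obtain ⟨b, hb⟩ := B.nonempty
    have := hfB b (subset_closure (subset_convexHull ℝ _ hb))
    simp only [zero_apply] at this hfa
    linarith
  have hn : ‖‖f‖⁻¹ • f‖ = 1 := norm_smul_inv_norm (𝕜 := ℝ) hf
  have hpos : 0 < ‖f‖⁻¹ := inv_pos.2 (norm_pos_iff.2 hf)
  let x : Omega X := ⟨‖f‖⁻¹ • f, by simp [hn]⟩
  have h1 : ‖f‖⁻¹ * f a ≤ J A x := le_J ha x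
  have h2 : J B x ≤ ‖f‖⁻¹ * c := J_le fun b hb =>
    mul_le_mul_of_nonneg_left (hfB b (subset_closure (subset_convexHull ℝ _ hb))).le hpos.le
  have h3 := h x hn
  have h4 : ‖f‖⁻¹ * c < ‖f‖⁻¹ * f a := mul_lt_mul_of_pos_left hfa hpos
  linarith

end SupportFunctions

/-! ### The lattice `E_𝒞` and homogeneity -/

section Lattice

variable {X : Type u} [NormedAddCommGroup X] [NormedSpace ℝ X]

theorem J_mem_EC (A : BddSet X) : J A ∈ EC X := J_closedCo A ▸ J_closedCo_mem A

/-- Support functions form a convex cone; a negative scalar swaps the two terms of a difference.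
Arbitrary bounded sets are allowed because `J` does not see the closed convex hull. -/
theorem mem_span_J {f : Omega X →ᵇ ℝ} :
    f ∈ Submodule.span ℝ (J '' ClosedConvex X) ↔ ∃ A B : BddSet X, f = J A - J B := by
  constructor
  · intro hf
    induction hf using Submodule.span_induction with
    | mem f hf =>
      obtain ⟨A, -, rfl⟩ := hf
      exact ⟨A, BddSet.point 0, by rw [J_point_zero, sub_zero]⟩
    | zero => exact ⟨BddSet.point 0, BddSet.point 0, by rw [sub_self]⟩
    | add f g _ _ hf hg =>
      obtain ⟨A, B, rfl⟩ := hf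
      obtain ⟨C, D, rfl⟩ := hg
      exact ⟨A + C, B + D, by rw [J_add, J_add]; abel⟩
    | smul k f _ hf =>
      obtain ⟨A, B, rfl⟩ := hf
      rcases le_total 0 k with hk | hk
      · exact ⟨k • A, k • B, by rw [J_smul _ hk, J_smul _ hk, smul_sub]⟩
      · refine ⟨(-k) • B, (-k) • A, ?_⟩
        rw [J_smul _ (neg_nonneg.2 hk), J_smul _ (neg_nonneg.2 hk), smul_sub]
        module
  · rintro ⟨A, B, rfl⟩
    have h : ∀ A : BddSet X, J A ∈ Submodule.span ℝ (J '' ClosedConvex X) := fun A => by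
      rw [← J_closedCo A]
      exact Submodule.subset_span
        ⟨A.closedCo, ⟨isClosed_closure, (convex_convexHull ℝ A.carrier).closure⟩, rfl⟩
    exact sub_mem (h A) (h B)

/-- Adding `J B + J D` to both `J A - J B` and `J C - J D` turns their supremum into one of support
functions, which is the support function of a union. Continuity of `⊔` passes to the closure. -/
theorem sup_mem_EC {f g : Omega X →ᵇ ℝ} (hf : f ∈ EC X) (hg : g ∈ EC X) : f ⊔ g ∈ EC X := by
  refine map_mem_closure₂ continuous_sup hf hg fun f hf g hg => ?_
  obtain ⟨A, B, rfl⟩ := mem_span_J.1 hf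
  obtain ⟨C, D, rfl⟩ := mem_span_J.1 hg
  refine mem_span_J.2 ⟨(A + D).union (C + B), B + D, ?_⟩
  rw [J_union, J_add, J_add, J_add]
  ext x
  simp only [BoundedContinuousFunction.coe_sup, BoundedContinuousFunction.coe_sub,
    BoundedContinuousFunction.coe_add, Pi.sup_apply, Pi.sub_apply, Pi.add_apply]
  rw [← max_sub_sub_right]
  congr 1 <;> ring

theorem inf_mem_EC {f g : Omega X →ᵇ ℝ} (hf : f ∈ EC X) (hg : g ∈ EC X) : f ⊓ g ∈ EC X := by
  have := neg_mem (sup_mem_EC (neg_mem hf) (neg_mem hg))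
  rwa [← neg_inf, neg_neg] at this

theorem homogeneous_of_mem_EC {f : Omega X →ᵇ ℝ} (hf : f ∈ EC X) {x y : Omega X} {t : ℝ}
    (ht : 0 ≤ t) (h : y.1 = t • x.1) : f y = t * f x := by
  have hcl : IsClosed {f : Omega X →ᵇ ℝ | f y = t * f x} :=
    isClosed_eq (continuous_eval_const _)
      (continuous_const.mul (continuous_eval_const _))
  refine closure_minimal (fun f hf => ?_) hcl hf
  obtain ⟨A, B, rfl⟩ := mem_span_J.1 hf
  simp only [Set.mem_ofPred_eq, BoundedContinuousFunction.coe_sub, Pi.sub_apply,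
    J_homogeneous A ht h, J_homogeneous B ht h, mul_sub]

/-- An inequality between elements of `E_𝒞` may be checked on the dual unit sphere. -/
theorem le_of_le_on_sphere {f g : Omega X →ᵇ ℝ} (hf : f ∈ EC X) (hg : g ∈ EC X)
    (h : ∀ x : Omega X, ‖x.1‖ = 1 → f x ≤ g x) : f ≤ g := by
  intro x
  by_cases hx : x.1 = 0
  · have e : x.1 = (0 : ℝ) • x.1 := by rw [hx, smul_zero]
    have h1 := homogeneous_of_mem_EC hf le_rfl e
    have h2 := homogeneous_of_mem_EC hg le_rfl e
    rw [zero_mul] at h1 h2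
    exact (h1.trans h2.symm).le
  · obtain ⟨y, hy, hxy⟩ := exists_unit_smul hx
    have h1 := homogeneous_of_mem_EC hf (norm_nonneg _) hxy
    have h2 := homogeneous_of_mem_EC hg (norm_nonneg _) hxy
    show f x ≤ g x
    rw [h1, h2]
    exact mul_le_mul_of_nonneg_left (h y hy) (norm_nonneg _)

end Lattice

/-! ### The ideal generated by compact sets -/

section Ideal

variable {X : Type u} [NormedAddCommGroup X] [NormedSpace ℝ X]

theorem BddSet.exists_isCompact_abs_J_le {C : BddSet X} (hC : IsCompact C.carrier) :
    ∃ D : BddSet X, IsCompact D.carrier ∧ ∀ x : Omega X, |J C x| ≤ J D x := by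
  have hn : IsCompact ((-1 : ℝ) • C.carrier) := hC.smul _
  refine ⟨C.union ((-1 : ℝ) • C), hC.union hn, fun x => ?_⟩
  rw [abs_le']
  refine ⟨J_mono Set.subset_union_left x, ?_⟩
  obtain ⟨a, ha⟩ := C.nonempty
  have h1 := le_J ha x
  have h2 := le_J (A := C.union ((-1 : ℝ) • C)) (Or.inr (Set.smul_mem_smul_set ha)) x
  rw [map_smul, smul_eq_mul] at h2
  linarith

variable (X) in
/-- The functions that are dominated on the dual unit sphere by support functions of compact sets,
up to arbitrarily small constants. -/
def compactlyDominated : Submodule ℝ (Omega X →ᵇ ℝ) where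
  carrier := {g | ∀ ε > 0, ∃ C : BddSet X, IsCompact C.carrier ∧
    ∀ x : Omega X, ‖x.1‖ = 1 → |g x| ≤ ε + J C x}
  zero_mem' ε hε := ⟨BddSet.point 0, isCompact_singleton, fun x _ => by
    simpa [J_point_zero] using hε.le⟩
  add_mem' {f g} hf hg ε hε := by
    obtain ⟨C, hC, hfC⟩ := hf (ε / 2) (half_pos hε)
    obtain ⟨D, hD, hgD⟩ := hg (ε / 2) (half_pos hε)
    refine ⟨C + D, hC.add hD, fun x hx => ?_⟩
    have h1 := hfC x hx
    have h2 := hgD x hx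
    have h3 := abs_add_le (f x) (g x)
    rw [J_add]
    simp only [BoundedContinuousFunction.coe_add, Pi.add_apply]
    linarith
  smul_mem' k f hf ε hε := by
    -- The summand 1 avoids dividing by zero when `k = 0`.
    have hk : 0 < |k| + 1 := by positivity
    obtain ⟨C, hC, hfC⟩ := hf (ε / (|k| + 1)) (div_pos hε hk)
    refine ⟨|k| • C, hC.smul _, fun x hx => ?_⟩
    have h1 := mul_le_mul_of_nonneg_left (hfC x hx) (abs_nonneg k)
    have h2 : |k| * (ε / (|k| + 1)) ≤ ε := by
      rw [mul_div_assoc', div_le_iff₀ hk]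
      nlinarith
    rw [J_smul _ (abs_nonneg k)]
    simp only [BoundedContinuousFunction.coe_smul, smul_eq_mul, abs_mul]
    linarith

theorem isClosed_compactlyDominated : IsClosed (compactlyDominated X : Set (Omega X →ᵇ ℝ)) := by
  refine isClosed_of_closure_subset fun g hg ε hε => ?_
  obtain ⟨f, hf, hfg⟩ := Metric.mem_closure_iff.1 hg (ε / 2) (half_pos hε)
  obtain ⟨C, hC, hfC⟩ := hf (ε / 2) (half_pos hε)
  refine ⟨C, hC, fun x hx => ?_⟩
  have h1 := hfC x hx
  have h2 : |g x - f x| ≤ dist g f := BoundedContinuousFunction.dist_coe_le_dist (f := g) (g := f) x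
  have h3 := abs_sub_abs_le_abs_sub (g x) (f x)
  linarith

theorem EK_le_compactlyDominated : EK X ≤ compactlyDominated X := by
  refine Submodule.topologicalClosure_minimal _ (Submodule.span_le.2 ?_)
    isClosed_compactlyDominated
  rintro _ ⟨C, hC, rfl⟩ ε hε
  obtain ⟨D, hD, h⟩ := BddSet.exists_isCompact_abs_J_le hC.1
  exact ⟨D, hD, fun x _ => (h x).trans (by linarith)⟩

variable (X) in
/-- The inclusion of `E_𝒞` into `C_b(Ω)`. -/
noncomputable def inclE : E X →ₗᵢ[ℝ] (Omega X →ᵇ ℝ) := (EC X).subtypeₗᵢ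

theorem inclE_apply (f : E X) : inclE X f = f.1 := rfl

/-- The compactly dominated elements of `E_𝒞` form a closed lattice ideal containing `E_𝒦`, hence
contain the smallest one. -/
theorem mem_compactlyDominated_of_mem_IK {h : E X} (hh : h ∈ IK X) :
    h.1 ∈ compactlyDominated X := by
  have h1 : IK X ≤ (compactlyDominated X).comap (inclE X).toLinearMap := by
    refine sInf_le ⟨?_, ?_, ?_⟩
    · exact isClosed_compactlyDominated.preimage (inclE X).continuous
    · intro y hy z hzy ε hε
      obtain ⟨C, hC, hyC⟩ := hy ε hε
      exact ⟨C, hC, fun x hx => (hzy x).trans (hyC x hx)⟩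
    · exact fun h hh => EK_le_compactlyDominated hh
  exact h1 hh

theorem isClosed_IK : IsClosed (IK X : Set (E X)) := by
  rw [IK, Submodule.coe_sInf]
  exact isClosed_biInter fun Y hY => hY.1

theorem isLatticeIdeal_IK : IsLatticeIdeal (IK X) := by
  intro y hy z hzy
  refine Submodule.mem_sInf.2 fun Y hY => ?_
  exact hY.2.1 y (Submodule.mem_sInf.1 hy Y hY) z hzy

theorem mem_IK_of_mem_EK {h : E X} (hh : h.1 ∈ EK X) : h ∈ IK X :=
  Submodule.mem_sInf.2 fun _ hY => hY.2.2 h hh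

theorem mem_IK_of_abs_le_on_sphere {y z : E X} (hy : y ∈ IK X)
    (h : ∀ x : Omega X, ‖x.1‖ = 1 → |z.1 x| ≤ y.1 x) : z ∈ IK X := by
  refine isLatticeIdeal_IK y hy z ?_
  have hz : |z.1| ∈ EC X := sup_mem_EC z.2 (neg_mem z.2)
  have hy' : |y.1| ∈ EC X := sup_mem_EC y.2 (neg_mem y.2)
  exact le_of_le_on_sphere hz hy' fun x hx => (h x hx).trans (le_abs_self _)

/-- The modulus of an element of `E_𝒞`. -/
noncomputable def absE (f : E X) : E X := ⟨|f.1|, sup_mem_EC f.2 (neg_mem f.2)⟩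

theorem absE_mem_IK {f : E X} (hf : f ∈ IK X) : absE f ∈ IK X :=
  isLatticeIdeal_IK f hf _ (abs_abs f.1).le

theorem absE_apply (f : E X) (x : Omega X) : (absE f).1 x = |f.1 x| := rfl

/-- The supremum of two elements of `E_𝒞`. -/
noncomputable def supE (f g : E X) : E X := ⟨f.1 ⊔ g.1, sup_mem_EC f.2 g.2⟩

theorem supE_apply (f g : E X) (x : Omega X) : (supE f g).1 x = max (f.1 x) (g.1 x) := rfl

/-- The infimum of two elements of `E_𝒞`. -/
noncomputable def infE (f g : E X) : E X := ⟨f.1 ⊓ g.1, inf_mem_EC f.2 g.2⟩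

theorem infE_apply (f g : E X) (x : Omega X) : (infE f g).1 x = min (f.1 x) (g.1 x) := rfl

end Ideal

/-! ### Representation of the quotient in `C(K)` -/

section Representation

variable (X : Type u) [NormedAddCommGroup X] [NormedSpace ℝ X]

/-- The unit sphere of the dual space. -/
abbrev DualSphere : Type u := {x : Omega X // ‖x.1‖ = 1}

variable {X}

/-- The extension of a bounded continuous function on a space to the Stone–Čech
compactification. -/
noncomputable def stoneCechExt {S : Type u} [TopologicalSpace S] (f : S →ᵇ ℝ) :
    C(StoneCech S, ℝ) :=
  have hf : Continuous fun x => (⟨f x, abs_le.1 (f.norm_coe_le_norm x)⟩ : Set.Icc (-‖f‖) ‖f‖) :=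
    f.continuous.subtype_mk _
  ⟨fun w => (stoneCechExtend hf w).1, continuous_subtype_val.comp (continuous_stoneCechExtend hf)⟩

theorem stoneCechExt_unit {S : Type u} [TopologicalSpace S] (f : S →ᵇ ℝ) (x : S) :
    stoneCechExt f (stoneCechUnit x) = f x := by
  simp [stoneCechExt]

theorem stoneCech_map_eq {S : Type u} [TopologicalSpace S] {f g : C(StoneCech S, ℝ)}
    (h : ∀ x : S, f (stoneCechUnit x) = g (stoneCechUnit x)) : f = g :=
  DFunLike.coe_injective <| stoneCech_hom_ext f.continuous g.continuous (funext h)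

theorem stoneCech_map_le {S : Type u} [TopologicalSpace S] {f g : C(StoneCech S, ℝ)}
    (h : ∀ x : S, f (stoneCechUnit x) ≤ g (stoneCechUnit x)) : f ≤ g := fun w =>
  denseRange_stoneCechUnit.induction_on w (isClosed_le f.continuous g.continuous) h

variable (X) in
/-- Restriction of the elements of `E_𝒞` to the dual sphere, extended to its Stone–Čech
compactification. -/
noncomputable def extE : E X →ₗ[ℝ] C(StoneCech (DualSphere X), ℝ) where
  toFun f := stoneCechExt (f.1.compContinuous ⟨Subtype.val, continuous_subtype_val⟩)
  map_add' f g := stoneCech_map_eq fun x => by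
    simp only [stoneCechExt_unit, ContinuousMap.add_apply]; rfl
  map_smul' k f := stoneCech_map_eq fun x => by
    simp only [stoneCechExt_unit, ContinuousMap.smul_apply]; rfl

theorem extE_unit (f : E X) (x : DualSphere X) : extE X f (stoneCechUnit x) = f.1 x.1 :=
  stoneCechExt_unit _ x

variable (X) in
/-- The points of the Stone–Čech compactification of the dual sphere where the ideal vanishes. -/
def hull : Set (StoneCech (DualSphere X)) := {w | ∀ h ∈ IK X, extE X h w = 0}

theorem isClosed_hull : IsClosed (hull X) := by
  have : hull X = ⋂ h ∈ IK X, {w | extE X h w = 0} := by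
    ext w; simp [hull]
  rw [this]
  exact isClosed_biInter fun h _ => isClosed_eq (extE X h).continuous continuous_const

instance : CompactSpace (hull X) := isCompact_iff_compactSpace.1 isClosed_hull.isCompact

variable (X) in
/-- Restriction of the extension to the hull of the ideal. -/
noncomputable def hullMap : E X →ₗ[ℝ] C(hull X, ℝ) where
  toFun f := (extE X f).restrict (hull X)
  map_add' f g := by rw [map_add]; rfl
  map_smul' k f := by rw [map_smul]; rfl

theorem hullMap_apply (f : E X) (w : hull X) : hullMap X f w = extE X f w.1 := rfl

theorem hullMap_mono {f g : E X} (h : f.1 ≤ g.1) : hullMap X f ≤ hullMap X g := fun w =>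
  stoneCech_map_le (f := extE X f) (g := extE X g)
    (fun x => by rw [extE_unit, extE_unit]; exact h x.1) w.1

theorem hullMap_eq_zero {h : E X} (hh : h ∈ IK X) : hullMap X h = 0 :=
  ContinuousMap.ext fun w => w.2 h hh

variable (X) in
/-- The order unit `J B_X` of `E_𝒞`. -/
noncomputable def unitE : E X := ⟨J (BddSet.unitBall X), J_mem_EC _⟩

theorem extE_unitE : extE X (unitE X) = 1 :=
  stoneCech_map_eq fun x => by rw [extE_unit]; exact J_unitBall x.2

theorem hullMap_unitE : hullMap X (unitE X) = 1 := by
  ext w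
  rw [hullMap_apply, extE_unitE]; rfl

theorem hullMap_sup {f g : E X} :
    hullMap X (supE f g) = hullMap X f ⊔ hullMap X g := by
  have : extE X (supE f g) = extE X f ⊔ extE X g :=
    stoneCech_map_eq fun x => by
      rw [ContinuousMap.sup_apply, extE_unit, extE_unit, extE_unit, supE_apply]
  ext w
  exact DFunLike.congr_fun this w.1

theorem hullMap_inf {f g : E X} :
    hullMap X (infE f g) = hullMap X f ⊓ hullMap X g := by
  have : extE X (infE f g) = extE X f ⊓ extE X g :=
    stoneCech_map_eq fun x => by
      rw [ContinuousMap.inf_apply, extE_unit, extE_unit, extE_unit, infE_apply]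
  ext w
  exact DFunLike.congr_fun this w.1

theorem norm_hullMap_le (f : E X) : ‖hullMap X f‖ ≤ ‖f‖ := by
  refine (ContinuousMap.norm_le _ (norm_nonneg f)).2 fun w => ?_
  rw [hullMap_apply]
  refine denseRange_stoneCechUnit.induction_on w.1
    (isClosed_le (extE X f).continuous.norm continuous_const) fun x => ?_
  rw [extE_unit]
  exact f.1.norm_coe_le_norm x.1

/-- A function less than `c` on the hull is less than `c + h` everywhere, with `h` in the ideal. -/
theorem exists_mem_IK_lt {f : E X} {c : ℝ} (hc : ∀ w : hull X, hullMap X f w < c) :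
    ∃ h ∈ IK X, (∀ x, 0 ≤ h.1 x) ∧ ∀ x : DualSphere X, f.1 x.1 < c + h.1 x.1 := by
  let U : {h : E X // h ∈ IK X ∧ ∀ x, 0 ≤ h.1 x} → Set (StoneCech (DualSphere X)) :=
    fun h => {w | extE X f w < c + extE X h.1 w}
  have hU : ∀ h, IsOpen (U h) := fun h =>
    isOpen_lt (extE X f).continuous (continuous_const.add (extE X h.1).continuous)
  have hcov : Set.univ ⊆ ⋃ h, U h := by
    intro w _
    by_cases hw : w ∈ hull X
    · refine Set.mem_iUnion.2 ⟨⟨0, zero_mem _, fun x => le_rfl⟩, ?_⟩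
      have := hc ⟨w, hw⟩
      rw [hullMap_apply] at this
      simpa [U] using this
    · have : ∃ h ∈ IK X, extE X h w ≠ 0 := by simpa [hull] using hw
      obtain ⟨h, hh, hne⟩ := this
      have habs : extE X (absE h) w = |extE X h w| := by
        have : extE X (absE h) = |extE X h| := stoneCech_map_eq fun x => by
          rw [ContinuousMap.abs_apply, extE_unit, extE_unit, absE_apply]
        rw [this, ContinuousMap.abs_apply]
      have hpos : 0 < |extE X h w| := abs_pos.2 hne
      -- Off the hull some `h` in the ideal is nonzero at `w`; this factor gives `k|h|` the value
      -- `|f - c| + 1` there, which exceeds `f - c`.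
      let k : ℝ := (|extE X f w - c| + 1) / |extE X h w|
      have hk : 0 ≤ k := by positivity
      refine Set.mem_iUnion.2 ⟨⟨k • absE h, Submodule.smul_mem _ _ (absE_mem_IK hh),
        fun x => mul_nonneg hk (abs_nonneg _)⟩, ?_⟩
      have e : extE X (k • absE h) w = |extE X f w - c| + 1 := by
        rw [map_smul, ContinuousMap.smul_apply, habs, smul_eq_mul, div_mul_cancel₀ _ hpos.ne']
      show _ < c + extE X (k • absE h) w
      rw [e]
      linarith [le_abs_self (extE X f w - c)]
  -- Since the chosen members of the ideal are nonnegative, the sum over a finite subcover works at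
  -- every point.
  obtain ⟨t, ht⟩ := isCompact_univ.elim_finite_subcover U hU hcov
  have hval : ∀ x : Omega X, (∑ h ∈ t, h.1).1 x = ∑ h ∈ t, h.1.1 x := fun x => by
    rw [← inclE_apply, map_sum, BoundedContinuousFunction.coe_sum, Finset.sum_apply]
    rfl
  refine ⟨∑ h ∈ t, h.1, Submodule.sum_mem _ fun h _ => h.2.1, fun x => ?_, fun x => ?_⟩
  · rw [hval]
    exact Finset.sum_nonneg fun h _ => h.2.2 x
  · have hx := ht (Set.mem_univ (stoneCechUnit x))
    simp only [Set.mem_iUnion] at hx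
    obtain ⟨h, hht, hxh⟩ := hx
    have hxh' : f.1 x.1 < c + h.1.1 x.1 := by
      have : extE X f (stoneCechUnit x) < c + extE X h.1 (stoneCechUnit x) := hxh
      rwa [extE_unit, extE_unit] at this
    rw [hval]
    have := Finset.single_le_sum (f := fun h => h.1.1 x.1) (fun h _ => h.2.2 x.1) hht
    linarith

/-- The distance to the ideal is attained on the hull. -/
theorem norm_mk_le_of_abs_hullMap_lt {f : E X} {c : ℝ} (hc0 : 0 ≤ c)
    (hc : ∀ w : hull X, |hullMap X f w| < c) :
    ‖(Submodule.Quotient.mk f : EQ X)‖ ≤ c := by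
  obtain ⟨h, hh, hpos, hlt⟩ := exists_mem_IK_lt (f := absE f) (c := c) fun w => by
    have : hullMap X (absE f) = hullMap X f ⊔ -hullMap X f := by
      rw [← map_neg, ← hullMap_sup]; rfl
    rw [this]
    exact hc w
  have hcu : c • J (BddSet.unitBall X) ∈ EC X := Submodule.smul_mem _ _ (J_mem_EC _)
  -- Truncation of `f` at `±c` on the sphere. It has norm at most `c`, and `|f| < c + h` there gives
  -- `|f - g| ≤ h`, so it lies in the class of `f`.
  let g : E X := ⟨(f.1 ⊓ c • J (BddSet.unitBall X)) ⊔ -(c • J (BddSet.unitBall X)),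
    sup_mem_EC (inf_mem_EC f.2 hcu) (neg_mem hcu)⟩
  have hg : ∀ x : Omega X, ‖x.1‖ = 1 → g.1 x = max (min (f.1 x) c) (-c) := fun x hx => by
    show max (min (f.1 x) (c * J (BddSet.unitBall X) x)) (-(c * J (BddSet.unitBall X) x)) = _
    rw [J_unitBall hx, mul_one]
  have hfg : f - g ∈ IK X := by
    refine mem_IK_of_abs_le_on_sphere hh fun x hx => ?_
    have h1 : (f - g).1 x = f.1 x - g.1 x := rfl
    have h2 : |f.1 x| < c + h.1 x := hlt ⟨x, hx⟩
    have h3 := hpos x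
    rw [h1, hg x hx]
    rw [abs_lt] at h2
    rw [abs_le]
    rcases min_cases (f.1 x) c with ⟨e1, _⟩ | ⟨e1, _⟩ <;>
    rcases max_cases (min (f.1 x) c) (-c) with ⟨e2, _⟩ | ⟨e2, _⟩ <;>
    constructor <;> linarith
  have heq : (Submodule.Quotient.mk f : EQ X) = Submodule.Quotient.mk g :=
    (Submodule.Quotient.eq _).2 hfg
  rw [heq]
  refine (Submodule.Quotient.norm_mk_le (IK X) g).trans ?_
  have hball : J (BddSet.unitBall X) ≤ 1 := fun x => J_le fun a ha => by
    have ha' : ‖a‖ ≤ 1 := mem_closedBall_zero_iff.1 ha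
    have hx' : ‖x.1‖ ≤ 1 := mem_closedBall_zero_iff.1 x.2
    calc x.1 a ≤ ‖x.1 a‖ := Real.le_norm_self _
      _ ≤ ‖x.1‖ * ‖a‖ := x.1.le_opNorm a
      _ ≤ 1 * 1 := by gcongr
      _ = 1 := one_mul 1
  have hab : |g.1| ≤ c • J (BddSet.unitBall X) :=
    le_of_le_on_sphere (sup_mem_EC g.2 (neg_mem g.2)) hcu fun x hx => by
      show |g.1 x| ≤ c * J (BddSet.unitBall X) x
      rw [hg x hx, J_unitBall hx, mul_one, abs_le]
      exact ⟨le_max_right _ _, max_le (min_le_right _ _) (by linarith)⟩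
  show ‖g.1‖ ≤ c
  refine (BoundedContinuousFunction.norm_le hc0).2 fun x => ?_
  calc ‖g.1 x‖ ≤ c * J (BddSet.unitBall X) x := hab x
    _ ≤ c * 1 := mul_le_mul_of_nonneg_left (hball x) hc0
    _ = c := mul_one c

variable (X) in
/-- The representation of the quotient lattice as a sublattice of `C(K)`. -/
noncomputable def representation : EQ X →ₗᵢ[ℝ] C(hull X, ℝ) where
  toLinearMap := (IK X).liftQ (hullMap X) fun _ hh => hullMap_eq_zero hh
  norm_map' q := by
    obtain ⟨f, rfl⟩ := Submodule.Quotient.mk_surjective _ q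
    change ‖hullMap X f‖ = _
    apply le_antisymm
    · refine le_of_forall_pos_le_add fun ε hε => ?_
      obtain ⟨g, hg, hlt⟩ := Submodule.Quotient.norm_mk_lt (Submodule.Quotient.mk f : EQ X) hε
      have : hullMap X f = hullMap X g := by
        rw [← sub_eq_zero, ← map_sub]
        exact hullMap_eq_zero ((Submodule.Quotient.eq _).1 hg.symm)
      rw [this]
      exact (norm_hullMap_le g).trans hlt.le
    -- The margin `ε` supplies the strict inequality needed for the open cover.
    · refine le_of_forall_pos_le_add fun ε hε =>
        norm_mk_le_of_abs_hullMap_lt (by positivity) fun w => ?_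
      have : |hullMap X f w| ≤ ‖hullMap X f‖ := (hullMap X f).norm_coe_le_norm w
      linarith

theorem representation_Q (f : E X) : representation X (Q f) = hullMap X f :=
  (IK X).liftQ_apply _ f

theorem mem_IK_of_hullMap_eq_zero {f : E X} (hf : hullMap X f = 0) : f ∈ IK X := by
  -- Closedness makes the quotient seminorm a norm, so the isometry is injective.
  have : IsClosed (IK X : Set (E X)) := isClosed_IK
  have : Q f = 0 := (representation X).injective (by rw [representation_Q, hf, map_zero])
  exact (Submodule.Quotient.mk_eq_zero _).1 this

theorem isOrderIsometry_representation : IsOrderIsometry (representation X) where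
  le_iff f g := by
    rw [representation_Q, representation_Q]
    constructor
    · intro h
      -- The positive part of `f - g` vanishes on the hull, hence lies in the ideal.
      refine ⟨supE (f - g) 0, mem_IK_of_hullMap_eq_zero ?_, fun x => ?_⟩
      · rw [hullMap_sup, map_sub, map_zero, sup_eq_right]
        exact sub_nonpos.2 h
      · show f.1 x ≤ g.1 x + max (f.1 x - g.1 x) 0
        linarith [le_max_left (f.1 x - g.1 x) 0]
    · rintro ⟨h, hh, hle⟩
      have h1 : hullMap X f ≤ hullMap X (g + h) := hullMap_mono hle
      rwa [map_add, hullMap_eq_zero hh, add_zero] at h1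
  sup_mem p q := by
    obtain ⟨f, rfl⟩ := Submodule.Quotient.mk_surjective _ p
    obtain ⟨g, rfl⟩ := Submodule.Quotient.mk_surjective _ q
    exact ⟨Q (supE f g), (representation_Q _).trans hullMap_sup⟩
  inf_mem p q := by
    obtain ⟨f, rfl⟩ := Submodule.Quotient.mk_surjective _ p
    obtain ⟨g, rfl⟩ := Submodule.Quotient.mk_surjective _ q
    exact ⟨Q (infE f g), (representation_Q _).trans hullMap_inf⟩

end Representation

/-! ### Monotonicity of convex MNCs with respect to `𝕋` -/

section Measures

variable {X : Type u} [NormedAddCommGroup X] [NormedSpace ℝ X]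

/-- The support function as an element of `E_𝒞`. -/
noncomputable def JE (A : BddSet X) : E X := ⟨J A, J_mem_EC A⟩

theorem TQJ_representation (B : BddSet X) :
    TQJ (representation X) B = hullMap X (JE B) :=
  (representation_Q _).trans (congrArg (hullMap X) (Subtype.ext (J_closedCo B)))

theorem TQJ_mono {A B : BddSet X} (h : A ≤ B) :
    TQJ (representation X) A ≤ TQJ (representation X) B := by
  rw [TQJ_representation, TQJ_representation]
  exact hullMap_mono fun x => J_mono h x

theorem TQJ_add (A B : BddSet X) :
    TQJ (representation X) (A + B) = TQJ (representation X) A + TQJ (representation X) B := by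
  simp only [TQJ_representation]
  rw [← map_add]
  exact congrArg _ (Subtype.ext (J_add A B))

theorem TQJ_smul (A : BddSet X) {k : ℝ} (hk : 0 ≤ k) :
    TQJ (representation X) (k • A) = k • TQJ (representation X) A := by
  simp only [TQJ_representation]
  rw [← map_smul]
  exact congrArg _ (Subtype.ext (J_smul A hk))

theorem TQJ_unitBall : TQJ (representation X) (BddSet.unitBall X) = 1 := by
  rw [TQJ_representation]
  exact hullMap_unitE

theorem TQJ_point (a : X) : TQJ (representation X) (BddSet.point a) = 0 := by
  rw [TQJ_representation]
  exact hullMap_eq_zero <| mem_IK_of_mem_EK <| Submodule.le_topologicalClosure _ <|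
    Submodule.subset_span ⟨BddSet.point a, ⟨isCompact_singleton, convex_singleton a⟩, rfl⟩

theorem TQJ_nonneg (B : BddSet X) : 0 ≤ TQJ (representation X) B := by
  obtain ⟨a, ha⟩ := B.nonempty
  rw [← TQJ_point a]
  exact TQJ_mono (Set.singleton_subset_iff.2 ha)

/-- Comparison in the quotient lattice, in terms of sets. -/
theorem exists_compact_of_TQJ_le {A B : BddSet X}
    (h : TQJ (representation X) A ≤ TQJ (representation X) B) {t : ℝ} (ht : 0 < t) :
    ∃ C : BddSet X, IsCompact C.carrier ∧
      A ≤ (B + t • BddSet.unitBall X + C + t • BddSet.unitBall X).co := by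
  rw [TQJ_representation, TQJ_representation, ← representation_Q, ← representation_Q,
    isOrderIsometry_representation.le_iff] at h
  obtain ⟨h, hh, hle⟩ := h
  obtain ⟨C, hC, hhC⟩ := mem_compactlyDominated_of_mem_IK hh t ht
  refine ⟨C, hC, ?_⟩
  -- On the sphere the constant `t` is the support function of `t B_X`.
  have hsub : A ≤ (B + t • BddSet.unitBall X + C).closedCo :=
    subset_closedCo_of_J_le fun x hx => by
      rw [J_add, J_add, J_smul _ ht.le]
      simp only [BoundedContinuousFunction.coe_add, Pi.add_apply,
        BoundedContinuousFunction.coe_smul, smul_eq_mul]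
      rw [J_unitBall hx]
      have h1 : J A x ≤ J B x + h.1 x := hle x
      have h2 := (le_abs_self _).trans (hhC x hx)
      linarith
  -- The second `t B_X` absorbs the closure, because `μ` is assumed invariant under `co` only.
  intro a ha
  obtain ⟨d, hd, hda⟩ := Metric.mem_closure_iff.1 (hsub ha) t ht
  show a ∈ convexHull ℝ ((B + t • BddSet.unitBall X + C).carrier +
    (t • BddSet.unitBall X).carrier)
  rw [convexHull_add]
  refine ⟨d, hd, a - d, subset_convexHull ℝ _ ?_, add_sub_cancel d a⟩
  show a - d ∈ t • Metric.closedBall (0 : X) 1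
  rw [smul_unitClosedBall_of_nonneg ht.le, mem_closedBall_zero_iff, ← dist_eq_norm]
  exact hda.le

theorem IsConvexMNC.eq_zero_of_isCompact {μ : BddSet X → ℝ} (hμ : IsConvexMNC μ) {C : BddSet X}
    (hC : IsCompact C.carrier) : μ C = 0 :=
  (hμ.noncompactness C).2 hC.closure

/-- Without subadditivity, a sum such as `B + C + 2t B_X` must be placed inside a convex
combination: `B` keeps a weight near 1, and the rest gets weights tending to 0 with `t`. Only `C` is
dilated without bound, at no cost. -/
theorem IsConvexMNC.le_of_TQJ_le {μ : BddSet X → ℝ} (hμ : IsConvexMNC μ) {A B : BddSet X}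
    (h : TQJ (representation X) A ≤ TQJ (representation X) B) : μ A ≤ μ B := by
  have key : ∀ t : ℝ, 0 < t → t < 1 / 2 →
      μ A ≤ (1 - 2 * t) * μ B + t * μ ((2 : ℝ) • B) +
        t / 2 * μ ((4 : ℝ) • BddSet.unitBall X) := by
    intro t ht ht'
    obtain ⟨C, hC, hAC⟩ := exists_compact_of_TQJ_le h ht
    -- The total weights are `1 - 2t` on `B`, `t` on `2B`, `t/2` on `4B_X` and `t/2` on `(2/t)C`.
    -- They sum to 1, and using the same `b` in `B` and `2B` recovers `b` exactly.
    let P : BddSet X := (1 / 2 : ℝ) • ((4 : ℝ) • BddSet.unitBall X) +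
      (1 - 1 / 2 : ℝ) • ((2 / t) • C)
    let R : BddSet X := (1 / 2 : ℝ) • ((2 : ℝ) • B) + (1 - 1 / 2 : ℝ) • P
    have hC0 : μ ((2 / t) • C) = 0 := hμ.eq_zero_of_isCompact (hC.smul _)
    have hP : μ P ≤ _ := hμ.convexity ((4 : ℝ) • BddSet.unitBall X) ((2 / t) • C) (1 / 2)
      (by norm_num) (by norm_num)
    have hR : μ R ≤ _ := hμ.convexity ((2 : ℝ) • B) P (1 / 2) (by norm_num) (by norm_num)
    have hS := hμ.convexity B R (1 - 2 * t) (by linarith) (by linarith)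
    have hsub : B + t • BddSet.unitBall X + C + t • BddSet.unitBall X ≤
        (1 - 2 * t) • B + (1 - (1 - 2 * t)) • R := by
      rintro _ ⟨_, ⟨_, ⟨b, hb, _, ⟨v, hv, rfl⟩, rfl⟩, c, hc, rfl⟩, _, ⟨w, hw, rfl⟩, rfl⟩
      have hvw : (2 : ℝ) • (v + w) ∈ ((4 : ℝ) • BddSet.unitBall X).carrier := by
        show _ ∈ (4 : ℝ) • Metric.closedBall (0 : X) 1
        rw [smul_unitClosedBall_of_nonneg (by norm_num), mem_closedBall_zero_iff, norm_smul]
        have h1 : ‖v‖ ≤ 1 := mem_closedBall_zero_iff.1 hv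
        have h2 : ‖w‖ ≤ 1 := mem_closedBall_zero_iff.1 hw
        have h3 := norm_add_le v w
        rw [Real.norm_ofNat]
        linarith
      have hp : (1 / 2 : ℝ) • ((2 : ℝ) • (v + w)) + (1 - 1 / 2 : ℝ) • ((2 / t) • c) ∈ P.carrier :=
        Set.add_mem_add (Set.smul_mem_smul_set hvw)
          (Set.smul_mem_smul_set (Set.smul_mem_smul_set hc))
      have hr : (1 / 2 : ℝ) • ((2 : ℝ) • b) + (1 - 1 / 2 : ℝ) •
          ((1 / 2 : ℝ) • ((2 : ℝ) • (v + w)) + (1 - 1 / 2 : ℝ) • ((2 / t) • c)) ∈ R.carrier :=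
        Set.add_mem_add (Set.smul_mem_smul_set (Set.smul_mem_smul_set hb))
          (Set.smul_mem_smul_set hp)
      refine ⟨(1 - 2 * t) • b, Set.smul_mem_smul_set hb, _, Set.smul_mem_smul_set hr, ?_⟩
      simp only
      match_scalars <;> field_simp <;> ring
    have h1 := hμ.monotone _ _ hAC
    rw [hμ.convexification] at h1
    have h2 := hμ.monotone _ _ hsub
    rw [hC0] at hP
    have h3 : (1 - (1 - 2 * t)) * μ R ≤ t * μ ((2 : ℝ) • B) +
        t / 2 * μ ((4 : ℝ) • BddSet.unitBall X) := by
      have : μ R ≤ 1 / 2 * μ ((2 : ℝ) • B) + 1 / 2 * (1 / 2 * μ ((4 : ℝ) • BddSet.unitBall X)) := by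
        linarith
      have := mul_le_mul_of_nonneg_left this (by linarith : 0 ≤ 1 - (1 - 2 * t))
      linarith
    linarith
  refine le_of_forall_pos_le_add fun ε hε => ?_
  let M : ℝ := μ ((2 : ℝ) • B) + 1 / 2 * μ ((4 : ℝ) • BddSet.unitBall X)
  have hM : 0 ≤ M := by
    have h1 := hμ.nonneg ((2 : ℝ) • B)
    have h2 := hμ.nonneg ((4 : ℝ) • BddSet.unitBall X)
    positivity
  -- The bound `1 / 4` keeps `t` below `1 / 2`; the quotient makes the error `t * M` at most `ε`.
  let t : ℝ := min (1 / 4) (ε / (M + 1))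
  have ht : 0 < t := lt_min (by norm_num) (by positivity)
  have h1 := key t ht ((min_le_left _ _).trans_lt (by norm_num))
  have h2 : t * (M + 1) ≤ ε := (le_div_iff₀ (by positivity)).1 (min_le_right _ _)
  have h3 : t * (M + 1) =
    t * μ ((2 : ℝ) • B) + t / 2 * μ ((4 : ℝ) • BddSet.unitBall X) + t := by
    simp only [M]; ring
  have h4 := mul_nonneg ht.le (hμ.nonneg B)
  linarith

end Measures

/-! ### The factor through `𝕋` and its Lipschitz bounds -/

section Factorization

variable {X : Type u} [NormedAddCommGroup X] [NormedSpace ℝ X]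

theorem IsSublinearMNC.isConvexMNC {μ : BddSet X → ℝ} (hμ : IsSublinearMNC μ) : IsConvexMNC μ where
  nonneg := hμ.nonneg
  noncompactness := hμ.noncompactness
  monotone := hμ.monotone
  convexification := hμ.convexification
  convexity A B t h0 h1 := by
    rw [← hμ.homogeneity A t h0, ← hμ.homogeneity B (1 - t) (sub_nonneg.2 h1)]
    exact hμ.subadditivity _ _

/-- The function on the image of `TQJ` through which `μ` factors. -/
noncomputable def factor (μ : BddSet X → ℝ) : C(hull X, ℝ) → ℝ :=
  Function.extend (TQJ (representation X)) μ 0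

/-- Well defined: `le_of_TQJ_le` applied in both directions shows that sets with equal image have
equal measure. -/
theorem IsConvexMNC.factor_TQJ {μ : BddSet X → ℝ} (hμ : IsConvexMNC μ) (B : BddSet X) :
    factor μ (TQJ (representation X) B) = μ B :=
  Function.FactorsThrough.extend_apply (fun _ _ h =>
    le_antisymm (hμ.le_of_TQJ_le h.le) (hμ.le_of_TQJ_le h.ge)) _ B

theorem TQJ_le_of_norm_le {B : BddSet X} {r : ℝ} (hr : 0 ≤ r)
    (h : ‖TQJ (representation X) B‖ ≤ r) :
    TQJ (representation X) B ≤ TQJ (representation X) (r • BddSet.unitBall X) := by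
  rw [TQJ_smul _ hr, TQJ_unitBall]
  intro w
  have h1 := (le_abs_self _).trans ((TQJ (representation X) B).norm_coe_le_norm w)
  simpa using h1.trans h

theorem TQJ_le_add_dist (A B : BddSet X) :
    TQJ (representation X) A ≤ TQJ (representation X) (B +
      ‖TQJ (representation X) A - TQJ (representation X) B‖ • BddSet.unitBall X) := by
  rw [TQJ_add, TQJ_smul _ (norm_nonneg _), TQJ_unitBall]
  intro w
  have h := (le_abs_self _).trans
    ((TQJ (representation X) A - TQJ (representation X) B).norm_coe_le_norm w)
  rw [ContinuousMap.sub_apply] at h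
  change TQJ (representation X) A w ≤ TQJ (representation X) B w + _ * 1
  linarith

/-- If `δ ≤ 1`, then `𝕋 A ≤ 𝕋 B + δ` is the convex combination of `𝕋 (B + B_X)` and `𝕋 B` with
weights `δ` and `1 - δ`, and `𝕋 (B + B_X) ≤ 1 + r`. If `δ ≥ 1`, the bound on `μ A` alone suffices.
-/
theorem IsConvexMNC.sub_le {μ : BddSet X → ℝ} (hμ : IsConvexMNC μ) {A B : BddSet X} {r : ℝ}
    (hr : 0 ≤ r) (hA : ‖TQJ (representation X) A‖ ≤ r) (hB : ‖TQJ (representation X) B‖ ≤ r) :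
    μ A - μ B ≤ μ ((1 + r) • BddSet.unitBall X) *
      ‖TQJ (representation X) A - TQJ (representation X) B‖ := by
  set δ := ‖TQJ (representation X) A - TQJ (representation X) B‖ with hδ
  have hδ0 : 0 ≤ δ := norm_nonneg _
  have hr1 : 0 ≤ 1 + r := by linarith
  have hc := hμ.nonneg ((1 + r) • BddSet.unitBall X)
  have hb := hμ.nonneg B
  rcases le_total δ 1 with h1 | h1
  · have hB' : TQJ (representation X) (B + BddSet.unitBall X) ≤
        TQJ (representation X) ((1 + r) • BddSet.unitBall X) := by
      have h := TQJ_le_of_norm_le hr hB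
      rw [TQJ_smul _ hr] at h
      rw [TQJ_add, TQJ_smul _ hr1, add_smul, one_smul, add_comm]
      exact add_le_add_right h _
    have hA' : TQJ (representation X) A ≤
        TQJ (representation X) (δ • (B + BddSet.unitBall X) + (1 - δ) • B) := by
      refine (TQJ_le_add_dist A B).trans_eq ?_
      rw [← hδ, TQJ_add, TQJ_add, TQJ_smul _ hδ0, TQJ_smul _ hδ0, TQJ_add,
        TQJ_smul _ (sub_nonneg.2 h1)]
      module
    have h2 := (hμ.le_of_TQJ_le hA').trans (hμ.convexity _ _ _ hδ0 h1)
    have h3 := mul_le_mul_of_nonneg_left (hμ.le_of_TQJ_le hB') hδ0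
    have h4 := mul_nonneg hδ0 hb
    linarith
  · have h2 := hμ.le_of_TQJ_le (TQJ_le_of_norm_le hr1 (hA.trans (by linarith)))
    have h3 := mul_le_mul_of_nonneg_left h1 hc
    linarith

theorem IsSublinearMNC.sub_le {μ : BddSet X → ℝ} (hμ : IsSublinearMNC μ) (A B : BddSet X) :
    μ A - μ B ≤ μ (BddSet.unitBall X) *
      ‖TQJ (representation X) A - TQJ (representation X) B‖ := by
  have h1 := hμ.isConvexMNC.le_of_TQJ_le (TQJ_le_add_dist A B)
  have h2 := h1.trans (hμ.subadditivity _ _)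
  rw [hμ.homogeneity _ _ (norm_nonneg _)] at h2
  linarith

end Factorization

end MNC

/-! ### The factorization theorem -/

theorem theorem3p11 (X : Type u) [NormedAddCommGroup X] [NormedSpace ℝ X] [CompleteSpace X] :
    ∃ (K : Type u) (_ : TopologicalSpace K) (_ : CompactSpace K) (_ : T2Space K)
      (T : MNC.EQ X →ₗᵢ[ℝ] C(K, ℝ)),
      MNC.IsOrderIsometry T ∧
      -- `𝕋 = TQJ` is order preserving, affine, with values in the positive cone
      (∀ A B : MNC.BddSet X, A ≤ B → MNC.TQJ T A ≤ MNC.TQJ T B) ∧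
      (∀ (A B : MNC.BddSet X) (a b : ℝ), 0 ≤ a → 0 ≤ b →
        MNC.TQJ T (a • A + b • B) = a • MNC.TQJ T A + b • MNC.TQJ T B) ∧
      (∀ B : MNC.BddSet X, 0 ≤ MNC.TQJ T B) ∧
      -- its image `V` is a cone
      (∀ f ∈ Set.range (MNC.TQJ T), ∀ g ∈ Set.range (MNC.TQJ T), ∀ a b : ℝ, 0 ≤ a → 0 ≤ b →
        a • f + b • g ∈ Set.range (MNC.TQJ T)) ∧
      ∀ μ : MNC.BddSet X → ℝ, MNC.IsConvexMNC μ →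
        ∃ F : C(K, ℝ) → ℝ,
          (∀ B, μ B = F (MNC.TQJ T B)) ∧
          (∀ f ∈ Set.range (MNC.TQJ T), 0 ≤ F f) ∧
          ConvexOn ℝ (Set.range (MNC.TQJ T)) F ∧
          MonotoneOn F (Set.range (MNC.TQJ T)) ∧
          (∀ r : ℝ, 0 ≤ r →
            F (r • MNC.TQJ T (MNC.BddSet.unitBall X)) = μ (r • MNC.BddSet.unitBall X) ∧
            ∀ f ∈ Set.range (MNC.TQJ T), ‖f‖ ≤ r →
              F f ≤ F (r • MNC.TQJ T (MNC.BddSet.unitBall X))) ∧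
          (∀ r : ℝ, 0 ≤ r →
            F ((1 + r) • MNC.TQJ T (MNC.BddSet.unitBall X)) =
              μ ((1 + r) • MNC.BddSet.unitBall X) ∧
            ∀ f ∈ Set.range (MNC.TQJ T), ∀ g ∈ Set.range (MNC.TQJ T), ‖f‖ ≤ r → ‖g‖ ≤ r →
              |F f - F g| ≤ μ ((1 + r) • MNC.BddSet.unitBall X) * ‖f - g‖) ∧
          (MNC.IsSublinearMNC μ → ∀ r : ℝ, 0 ≤ r →
            ∀ f ∈ Set.range (MNC.TQJ T), ∀ g ∈ Set.range (MNC.TQJ T), ‖f‖ ≤ r → ‖g‖ ≤ r →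
              |F f - F g| ≤ μ (MNC.BddSet.unitBall X) * ‖f - g‖) := by
  refine ⟨MNC.hull X, inferInstance, inferInstance, inferInstance, MNC.representation X,
    MNC.isOrderIsometry_representation, fun A B h => MNC.TQJ_mono h, ?_, MNC.TQJ_nonneg, ?_, ?_⟩
  · intro A B a b ha hb
    rw [MNC.TQJ_add, MNC.TQJ_smul _ ha, MNC.TQJ_smul _ hb]
  · rintro _ ⟨A, rfl⟩ _ ⟨B, rfl⟩ a b ha hb
    exact ⟨a • A + b • B, by rw [MNC.TQJ_add, MNC.TQJ_smul _ ha, MNC.TQJ_smul _ hb]⟩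
  · intro μ hμ
    have hball : ∀ r : ℝ, 0 ≤ r →
        MNC.factor μ (r • MNC.TQJ (MNC.representation X) (MNC.BddSet.unitBall X)) =
          μ (r • MNC.BddSet.unitBall X) := fun r hr => by
      rw [← MNC.TQJ_smul _ hr, hμ.factor_TQJ]
    refine ⟨MNC.factor μ, fun B => (hμ.factor_TQJ B).symm, ?_, ⟨?_, ?_⟩, ?_, ?_, ?_, ?_⟩
    · rintro _ ⟨B, rfl⟩
      rw [hμ.factor_TQJ]
      exact hμ.nonneg B
    · rintro _ ⟨A, rfl⟩ _ ⟨B, rfl⟩ a b ha hb -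
      exact ⟨a • A + b • B, by rw [MNC.TQJ_add, MNC.TQJ_smul _ ha, MNC.TQJ_smul _ hb]⟩
    · rintro _ ⟨A, rfl⟩ _ ⟨B, rfl⟩ a b ha hb hab
      obtain rfl : b = 1 - a := by linarith
      rw [← MNC.TQJ_smul _ ha, ← MNC.TQJ_smul _ hb, ← MNC.TQJ_add]
      simp only [hμ.factor_TQJ, smul_eq_mul]
      exact hμ.convexity A B a ha (by linarith)
    · rintro _ ⟨A, rfl⟩ _ ⟨B, rfl⟩ h
      rw [hμ.factor_TQJ, hμ.factor_TQJ]
      exact hμ.le_of_TQJ_le h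
    · refine fun r hr => ⟨hball r hr, ?_⟩
      rintro _ ⟨A, rfl⟩ hA
      rw [hball r hr, hμ.factor_TQJ]
      exact hμ.le_of_TQJ_le (MNC.TQJ_le_of_norm_le hr hA)
    · refine fun r hr => ⟨hball _ (by linarith), ?_⟩
      rintro _ ⟨A, rfl⟩ _ ⟨B, rfl⟩ hA hB
      rw [hμ.factor_TQJ, hμ.factor_TQJ, abs_le']
      refine ⟨hμ.sub_le hr hA hB, ?_⟩
      rw [neg_sub, norm_sub_rev]
      exact hμ.sub_le hr hB hA
    · rintro hs r - _ ⟨A, rfl⟩ _ ⟨B, rfl⟩ - -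
      rw [hμ.factor_TQJ, hμ.factor_TQJ, abs_le']
      refine ⟨hs.sub_le A B, ?_⟩
      rw [neg_sub, norm_sub_rev]
      exact hs.sub_le B A
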